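/- Let $\gamma\in(1,2)$ and let $\mathscr{D}$ be a random variable with values in $\{0,1,2,\dots\}$ such that $\mathbb{P}(\mathscr{D}>t)=\mathcal{L}(t)\,t^{-\gamma}$ for all $t>0$, where $\mathcal{L}$ is slowly varying at infinity (i.e. eventually positive and measurable, with $\mathcal{L}(ct)/\mathcal{L}(t)\to 1$ as $t\to\infty$ for every $c>0$). For every $n$, let $D_1,\dots,D_n$ be i.i.d. copies of $\mathscr{D}$, where $D_n$ is replaced by $D_n+1$ if $D_1+\dots+D_n$ is odd. Conditionally on these degrees, attach to every vertex $i\in\{1,\dots,n\}$ as many stubs (half-edges) as its degree, and let $G_n$ be the random multigraph obtained from a uniformly random perfect matching of all stubs, each matched pair of stubs forming an edge (the configuration model). For $i\neq j$ let $X_{ij}$ be the number of edges of $G_n$ between $i$ and $j$, and let $X_{ii}$ be the number of self-loops at $i$. The erased configuration model is the simple graph obtained from $G_n$ by deleting all self-loops and replacing multiple edges by single edges, and the number of edges removed in this way is $$Z_n=\sum_{i=1}^n X_{ii}+\sum_{1\le i<j\le n}\bigl(X_{ij}-\mathbf{1}\{X_{ij}>0\}\bigr).$$ Then, for every $\delta>0$,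 $$\frac{Z_n}{n^{2-\gamma+\delta}}\longrightarrow 0\quad\text{in probability as } n\to\infty.$$ -/

import Mathlib

open MeasureTheory ProbabilityTheory Filter Topology
open scoped ENNReal

/-- `L` is slowly varying at infinity: on some half-line `[a, ∞)` it is positive and measurable,
and `L (c t) / L t → 1` as `t → ∞` for every `c > 0`. -/
def SlowlyVarying (L : ℝ → ℝ) : Prop :=
  (∃ a : ℝ, (∀ t, a ≤ t → 0 < L t) ∧ Measurable (fun t : Set.Ici a => L t)) ∧
    ∀ c : ℝ, 0 < c → Tendsto (fun t => L (c * t) / L t) atTop (𝓝 1)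

/-- The distribution `ν` on the non-negative integers is regularly varying with exponent `γ`:
`ℙ(𝒟 > t) = L(t) t ^ (-γ)` for all `t > 0`, with `L` slowly varying at infinity. -/
def HasRegularlyVaryingTail (ν : Measure ℕ) (γ : ℝ) : Prop :=
  ∃ L : ℝ → ℝ, SlowlyVarying L ∧
    ∀ t : ℝ, 0 < t → ν.real {k : ℕ | t < (k : ℝ)} = L t * t ^ (-γ)

/-- A multigraph on the vertex set `Fin n`, given by its edge multiplicities: `X s(i, j)` is the
number of edges between `i` and `j`, and `X s(i, i)` is the number of self-loops at `i`. -/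
abbrev Multigraph (n : ℕ) : Type := Sym2 (Fin n) → ℕ

/-- The stubs (half-edges) of the degree sequence `d`: vertex `i` carries `d i` of them. -/
abbrev Stub {n : ℕ} (d : Fin n → ℕ) : Type := Σ i : Fin n, Fin (d i)

/-- A pairing (perfect matching) of the stubs, as an involution without fixed points. -/
abbrev Pairing {n : ℕ} (d : Fin n → ℕ) : Type :=
  {σ : Equiv.Perm (Stub d) // ∀ s, σ s ≠ s ∧ σ (σ s) = s}

/-- The multigraph of a pairing: every matched pair of stubs `{s, σ s}` becomes one edge between
the vertices that carry `s` and `σ s`. -/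
def Pairing.multigraph {n : ℕ} {d : Fin n → ℕ} (σ : Pairing d) : Multigraph n := fun e =>
  ((Finset.univ.image fun s : Stub d => s(s, σ.1 s)).filter
    fun p => p.map Sigma.fst = e).card

/-- The probability that a uniformly random pairing of the stubs of `d` (with even sum) produces
the multigraph `g`. -/
noncomputable def cmProb {n : ℕ} (d : Fin n → ℕ) (g : Multigraph n) : ℝ≥0∞ :=
  ((Finset.univ.filter fun σ : Pairing d => σ.multigraph = g).card : ℝ≥0∞) /
    (Fintype.card (Pairing d) : ℝ≥0∞)

/-- If the sum of the degrees is odd, the degree of the last vertex is increased by one. -/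
def evenCorrection {n : ℕ} (d : Fin n → ℕ) : Fin n → ℕ := fun i =>
  if Odd (∑ j, d j) ∧ (i : ℕ) + 1 = n then d i + 1 else d i

/-- The random multigraph `G` is a configuration model with the random degree sequence `D`:
conditionally on `D = d`, it is the multigraph of a uniformly random pairing of the stubs of `d`
(with the parity correction). -/
structure IsConfigurationModel {Ω : Type*} [MeasurableSpace Ω] (P : Measure Ω) {n : ℕ}
    (D : Fin n → Ω → ℕ) (G : Ω → Multigraph n) : Prop where
  measurable : Measurable G
  cond_law : ∀ (d : Fin n → ℕ) (g : Multigraph n),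
    P {ω | (∀ i, D i ω = d i) ∧ G ω = g} =
      P {ω | ∀ i, D i ω = d i} * cmProb (evenCorrection d) g

/-- The number of edges removed from the multigraph `X` when all self-loops are deleted and
multiple edges are replaced by a single edge. -/
def removedEdges {n : ℕ} (X : Multigraph n) : ℕ :=
  (∑ i : Fin n, X s(i, i)) +
    ∑ i : Fin n, ∑ j ∈ Finset.univ.filter (fun j : Fin n => i < j),
      (X s(i, j) - if 0 < X s(i, j) then 1 else 0)

/-! Fix the degrees, with total `L`. In a uniform pairing two given stubs are matched with
probability at most `1/(L-1)`, and two given disjoint pairs of stubs are both matched with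
probability at most `1/((L-1)(L-3))`. With `x = d i * d j / L`, the expected excess of edges between
`i ≠ j` is therefore at most `2x` and also at most `8x²`, hence at most `8x^s` for every `s ∈
[1,2]`. Loops are treated alike, using `d i ≤ L`. Summing gives `sum_removedEdges_le`: the expected
number of removed edges is at most `8(S/L^(s-1) + S²/L^s)`, where `S = ∑ d_i^s`.

Take `s < γ` close to `γ`. The `s`-th moment is finite, so Markov gives `S ≤ n^(1+η)` with high
probability (`tendsto_measure_le_sum_rpow`), and a Chernoff bound gives `L ≥ c n`
(`exists_tendsto_measure_sum_le`). On these degrees the expectation is of order at most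
`n^(2-s+2η)`, of smaller order than `n^(2-γ+δ)`. A conditional Markov inequality
(`IsConfigurationModel.measure_le`) concludes. -/

/-! ### Matching probabilities in a uniform pairing, by symmetry -/

section Pairings

variable {α : Type*}

/-- Conjugation of a fixed-point-free involution by a permutation. -/
def conjInvolution (τ : Equiv.Perm α)
    (σ : {σ : Equiv.Perm α // ∀ s, σ s ≠ s ∧ σ (σ s) = s}) :
    {σ : Equiv.Perm α // ∀ s, σ s ≠ s ∧ σ (σ s) = s} :=
  ⟨τ * σ.1 * τ⁻¹, fun s => by
    refine ⟨fun h => (σ.2 (τ⁻¹ s)).1 ?_, ?_⟩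
    · apply τ.injective
      simpa using h
    · change τ (σ.1 (τ.symm (τ (σ.1 (τ.symm s))))) = s
      rw [τ.symm_apply_apply, (σ.2 _).2, τ.apply_symm_apply]⟩

theorem conjInvolution_injective (τ : Equiv.Perm α) :
    Function.Injective (conjInvolution τ) := by
  intro σ σ' h
  have h' := congrArg Subtype.val h
  simp only [conjInvolution] at h'
  exact Subtype.ext (mul_left_cancel (mul_right_cancel h'))

variable [Fintype α] [DecidableEq α]

/-- Conjugation by `swap t t'` fixes `s` and preserves `Q`, so it injects the pairings with `σ s =
t` into those with `σ s = t'`. As `t'` runs over `T` these classes are disjoint. This replaces an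
explicit count of all pairings. -/
theorem card_mul_card_involution_le
    (Q : {σ : Equiv.Perm α // ∀ s, σ s ≠ s ∧ σ (σ s) = s} → Prop) [DecidablePred Q]
    (T : Finset α) {s t : α} (hs : s ∉ T) (ht : t ∈ T)
    (hQ : ∀ σ, Q σ → ∀ t' ∈ T, Q (conjInvolution (Equiv.swap t t') σ)) :
    T.card * (Finset.univ.filter fun σ => Q σ ∧ σ.1 s = t).card ≤
      (Finset.univ.filter Q).card := by
  have hst : s ≠ t := fun h => hs (h ▸ ht)
  have h1 : ∀ t' ∈ T, (Finset.univ.filter fun σ => Q σ ∧ σ.1 s = t).card ≤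
      (Finset.univ.filter fun σ => Q σ ∧ σ.1 s = t').card := by
    intro t' ht'
    have hst' : s ≠ t' := fun h => hs (h ▸ ht')
    refine Finset.card_le_card_of_injOn (conjInvolution (Equiv.swap t t')) ?_
      (conjInvolution_injective _).injOn
    intro σ hσ
    simp only [Finset.coe_filter, Finset.mem_univ, true_and, Set.mem_ofPred_eq] at hσ ⊢
    refine ⟨hQ σ hσ.1 t' ht', ?_⟩
    simp [conjInvolution, Equiv.swap_apply_of_ne_of_ne hst hst', hσ.2]
  calc T.card * (Finset.univ.filter fun σ => Q σ ∧ σ.1 s = t).card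
      ≤ ∑ t' ∈ T, (Finset.univ.filter fun σ => Q σ ∧ σ.1 s = t').card := by
        simpa using Finset.card_nsmul_le_sum T _ _ h1
    _ = (T.biUnion fun t' => Finset.univ.filter fun σ => Q σ ∧ σ.1 s = t').card := by
        rw [Finset.card_biUnion]
        intro a _ b _ hab
        refine Finset.disjoint_left.2 fun σ ha hb => hab ?_
        simp only [Finset.mem_filter] at ha hb
        exact ha.2.2.symm.trans hb.2.2
    _ ≤ (Finset.univ.filter Q).card := by
        refine Finset.card_le_card fun σ hσ => ?_
        simp only [Finset.mem_biUnion, Finset.mem_filter, Finset.mem_univ, true_and] at hσ ⊢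
        exact hσ.choose_spec.2.1

theorem card_involution_apply_eq_le {s t : α} (hst : s ≠ t) :
    (Fintype.card α - 1) *
      (Finset.univ.filter fun σ : {σ : Equiv.Perm α // ∀ s, σ s ≠ s ∧ σ (σ s) = s} =>
        σ.1 s = t).card ≤
      Fintype.card {σ : Equiv.Perm α // ∀ s, σ s ≠ s ∧ σ (σ s) = s} := by
  have := card_mul_card_involution_le (fun _ => True) (Finset.univ.erase s) (s := s) (t := t)
    (by simp) (by simpa using hst.symm) (by simp)
  simpa [Finset.card_erase_of_mem, Finset.card_univ] using this

theorem card_involution_apply_eq_and_le {s t s' t' : α} (hst : s ≠ t) (hss' : s ≠ s')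
    (hst' : s ≠ t') (hts' : t ≠ s') (htt' : t ≠ t') (hst'' : s' ≠ t') :
    (Fintype.card α - 1) * (Fintype.card α - 3) *
      (Finset.univ.filter fun σ : {σ : Equiv.Perm α // ∀ s, σ s ≠ s ∧ σ (σ s) = s} =>
        σ.1 s = t ∧ σ.1 s' = t').card ≤
      Fintype.card {σ : Equiv.Perm α // ∀ s, σ s ≠ s ∧ σ (σ s) = s} := by
  -- The partner of `s'` is moved within the complement of `{s, t, s'}`, so the swaps leave the
  -- match of `s` with `t` intact.
  have h := card_mul_card_involution_le
    (fun σ : {σ : Equiv.Perm α // ∀ s, σ s ≠ s ∧ σ (σ s) = s} => σ.1 s = t)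
    (({s, t, s'} : Finset α)ᶜ) (s := s') (t := t')
    (by simp) (by simp [hst'.symm, htt'.symm, hst''.symm]) (by
      intro σ hσ u hu
      simp only [Finset.mem_compl, Finset.mem_insert, Finset.mem_singleton, not_or] at hu
      simp [conjInvolution, Equiv.swap_apply_of_ne_of_ne hst' (Ne.symm hu.1), hσ,
        Equiv.swap_apply_of_ne_of_ne htt' (Ne.symm hu.2.1)])
  rw [Finset.card_compl, Finset.card_eq_three.2 ⟨s, t, s', hst, hss', hts', rfl⟩] at h
  calc _ = (Fintype.card α - 1) * _ := mul_assoc _ _ _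
    _ ≤ (Fintype.card α - 1) * _ := Nat.mul_le_mul_left _ h
    _ ≤ _ := card_involution_apply_eq_le hst

end Pairings

/-! ### Expected loops and multiple edges for fixed degrees -/

section Crossings

variable {n : ℕ} {d : Fin n → ℕ}

/-- The stubs of vertex `i` that the pairing matches to a stub of vertex `j`. -/
def crossing (σ : Pairing d) (i j : Fin n) : Finset (Stub d) :=
  Finset.univ.filter fun s => s.1 = i ∧ (σ.1 s).1 = j

/-- Each edge is the image of a stub at `i` matched to one at `j`. Loops are hit from both ends, so
only an inequality holds. -/
theorem multigraph_le_card_crossing (σ : Pairing d) (i j : Fin n) :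
    σ.multigraph s(i, j) ≤ (crossing σ i j).card := by
  refine le_trans (Finset.card_le_card ?_)
    (Finset.card_image_le (s := crossing σ i j) (f := fun s => s(s, σ.1 s)))
  intro p hp
  simp only [Finset.mem_filter, Finset.mem_image, Finset.mem_univ, true_and] at hp
  obtain ⟨⟨s, rfl⟩, hs⟩ := hp
  rw [Sym2.map_mk, Sym2.eq_iff] at hs
  rcases hs with ⟨h1, h2⟩ | ⟨h1, h2⟩
  · exact Finset.mem_image.2 ⟨s, by simp [crossing, h1, h2], rfl⟩
  · refine Finset.mem_image.2 ⟨σ.1 s, by simp [crossing, h1, h2, (σ.2 s).2], ?_⟩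
    rw [(σ.2 s).2, Sym2.eq_swap]

theorem card_stub : Fintype.card (Stub d) = ∑ i, d i := by simp

theorem card_filter_stub_fst (i : Fin n) :
    (Finset.univ.filter fun s : Stub d => s.1 = i).card = d i := by
  rw [← Finset.card_univ.trans (Fintype.card_fin (d i)),
    ← Finset.card_map (Function.Embedding.sigmaMk (β := fun i => Fin (d i)) i)]
  congr 1
  ext ⟨a, b⟩
  simp only [Finset.mem_filter, Finset.mem_univ, true_and, Finset.mem_map,
    Function.Embedding.sigmaMk_apply]
  constructor
  · rintro rfl
    exact ⟨b, rfl⟩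
  · rintro ⟨c, hc⟩
    exact (congrArg Sigma.fst hc).symm

theorem card_crossing_eq (σ : Pairing d) (i j : Fin n) :
    (crossing σ i j).card = ∑ s : Stub d with s.1 = i, ∑ t : Stub d with t.1 = j,
      if σ.1 s = t then 1 else 0 := by
  rw [crossing, ← Finset.filter_filter, Finset.card_filter]
  refine Finset.sum_congr rfl fun s _ => ?_
  simp [Finset.sum_ite_eq]

theorem sum_mul_card_crossing_le (hL : 4 ≤ ∑ i, d i) (i j : Fin n) :
    (∑ k, d k) * ∑ σ : Pairing d, (crossing σ i j).card ≤
      2 * (d i * d j) * Fintype.card (Pairing d) := by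
  have key : ∀ s t : Stub d, (∑ k, d k) * (∑ σ : Pairing d, if σ.1 s = t then 1 else 0) ≤
      2 * Fintype.card (Pairing d) := by
    intro s t
    rw [← Finset.card_filter]
    by_cases hst : s = t
    · subst hst
      rw [Finset.filter_false_of_mem fun σ _ => (σ.2 s).1]
      simp
    · have := card_involution_apply_eq_le hst
      rw [card_stub] at this
      refine le_trans (Nat.mul_le_mul_right _ (?_ : _ ≤ 2 * ((∑ k, d k) - 1))) ?_
      · omega
      · rw [mul_assoc]
        exact Nat.mul_le_mul_left _ this
  calc (∑ k, d k) * ∑ σ : Pairing d, (crossing σ i j).card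
      = ∑ s : Stub d with s.1 = i, ∑ t : Stub d with t.1 = j,
        (∑ k, d k) * (∑ σ : Pairing d, if σ.1 s = t then 1 else 0) := by
        simp_rw [card_crossing_eq, ← Finset.mul_sum]
        congr 1
        rw [Finset.sum_comm]
        exact Finset.sum_congr rfl fun s _ => Finset.sum_comm
    _ ≤ ∑ s : Stub d with s.1 = i, ∑ t : Stub d with t.1 = j,
        2 * Fintype.card (Pairing d) :=
        Finset.sum_le_sum fun s _ => Finset.sum_le_sum fun t _ => key s t
    _ = _ := by
        simp only [Finset.sum_const, card_filter_stub_fst, smul_eq_mul]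
        ring

/-- The left side counts ordered pairs of distinct crossing stubs. Splitting by their partners
reduces its mean to two-match probabilities. -/
theorem card_crossing_mul_pred_le (σ : Pairing d) (i j : Fin n) :
    (crossing σ i j).card * ((crossing σ i j).card - 1) ≤
      ∑ s : Stub d with s.1 = i, ∑ s' : Stub d with s'.1 = i,
      ∑ t : Stub d with t.1 = j, ∑ t' : Stub d with t'.1 = j,
        if s ≠ s' ∧ σ.1 s = t ∧ σ.1 s' = t' then 1 else 0 := by
  rw [Nat.mul_sub_one, ← Finset.offDiag_card]
  have h : (crossing σ i j).offDiag =
      ((Finset.univ.filter fun s : Stub d => s.1 = i) ×ˢ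
        (Finset.univ.filter fun s : Stub d => s.1 = i)).filter
        fun p => p.1 ≠ p.2 ∧ (σ.1 p.1).1 = j ∧ (σ.1 p.2).1 = j := by
    ext ⟨s, s'⟩
    simp only [crossing, Finset.mem_offDiag, Finset.mem_filter, Finset.mem_univ, true_and,
      Finset.mem_product]
    tauto
  rw [h, Finset.card_filter, Finset.sum_product]
  refine Finset.sum_le_sum fun s _ => Finset.sum_le_sum fun s' _ => ?_
  split_ifs with hc
  · refine le_trans ?_ (Finset.single_le_sum (fun _ _ => Nat.zero_le _)
      (Finset.mem_filter.2 ⟨Finset.mem_univ (σ.1 s), hc.2.1⟩))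
    refine le_trans ?_ (Finset.single_le_sum (fun _ _ => Nat.zero_le _)
      (Finset.mem_filter.2 ⟨Finset.mem_univ (σ.1 s'), hc.2.2⟩))
    simp [hc.1]
  · exact Nat.zero_le _

theorem sum_sq_mul_card_crossing_mul_pred_le (hL : 4 ≤ ∑ i, d i) {i j : Fin n} (hij : i ≠ j) :
    (∑ k, d k) ^ 2 * ∑ σ : Pairing d, (crossing σ i j).card * ((crossing σ i j).card - 1) ≤
      8 * (d i * d j) ^ 2 * Fintype.card (Pairing d) := by
  have key : ∀ s s' t t' : Stub d, s.1 = i → s'.1 = i → t.1 = j → t'.1 = j →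
      (∑ k, d k) ^ 2 * (∑ σ : Pairing d, if s ≠ s' ∧ σ.1 s = t ∧ σ.1 s' = t' then 1 else 0) ≤
      8 * Fintype.card (Pairing d) := by
    intro s s' t t' hs hs' ht ht'
    rw [← Finset.card_filter]
    by_cases hss : s = s'
    · simp [hss]
    by_cases htt : t = t'
    · rw [Finset.filter_false_of_mem]
      · simp
      · rintro σ _ ⟨_, h1, h2⟩
        exact hss (σ.1.injective (h1.trans (htt.trans h2.symm)))
    have hne : ∀ u v : Stub d, u.1 = i → v.1 = j → u ≠ v := by
      rintro u v hu hv rfl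
      exact hij (hu.symm.trans hv)
    have := card_involution_apply_eq_and_le (hne s t hs ht) hss (hne s t' hs ht')
      (hne s' t hs' ht).symm htt (hne s' t' hs' ht')
    rw [card_stub] at this
    simp only [ne_eq, hss, not_false_eq_true, true_and]
    refine le_trans (Nat.mul_le_mul_right _
      (?_ : _ ≤ 8 * (((∑ k, d k) - 1) * ((∑ k, d k) - 3)))) ?_
    -- `L² ≤ 8(L-1)(L-3)` for `L ≥ 4`; at `L = 3` the right side vanishes.
    · obtain ⟨m, hm⟩ := Nat.exists_eq_add_of_le hL
      rw [hm, show 4 + m - 1 = 3 + m by omega, show 4 + m - 3 = 1 + m by omega]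
      nlinarith
    · rw [mul_assoc]
      exact Nat.mul_le_mul_left _ this
  calc (∑ k, d k) ^ 2 * ∑ σ : Pairing d, (crossing σ i j).card * ((crossing σ i j).card - 1)
      ≤ (∑ k, d k) ^ 2 * ∑ σ : Pairing d, ∑ s : Stub d with s.1 = i,
        ∑ s' : Stub d with s'.1 = i, ∑ t : Stub d with t.1 = j, ∑ t' : Stub d with t'.1 = j,
        if s ≠ s' ∧ σ.1 s = t ∧ σ.1 s' = t' then 1 else 0 :=
        Nat.mul_le_mul_left _ (Finset.sum_le_sum fun σ _ => card_crossing_mul_pred_le σ i j)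
    _ = ∑ s : Stub d with s.1 = i,
        ∑ s' : Stub d with s'.1 = i, ∑ t : Stub d with t.1 = j, ∑ t' : Stub d with t'.1 = j,
        (∑ k, d k) ^ 2 *
          ∑ σ : Pairing d, if s ≠ s' ∧ σ.1 s = t ∧ σ.1 s' = t' then 1 else 0 := by
        simp_rw [← Finset.mul_sum]
        congr 1
        rw [Finset.sum_comm]
        refine Finset.sum_congr rfl fun s _ => ?_
        rw [Finset.sum_comm]
        refine Finset.sum_congr rfl fun s' _ => ?_
        rw [Finset.sum_comm]
        exact Finset.sum_congr rfl fun t _ => Finset.sum_comm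
    _ ≤ ∑ s : Stub d with s.1 = i, ∑ s' : Stub d with s'.1 = i,
        ∑ t : Stub d with t.1 = j, ∑ t' : Stub d with t'.1 = j,
        8 * Fintype.card (Pairing d) :=
        Finset.sum_le_sum fun s hs => Finset.sum_le_sum fun s' hs' =>
          Finset.sum_le_sum fun t ht => Finset.sum_le_sum fun t' ht' =>
          key s s' t t' (Finset.mem_filter.1 hs).2 (Finset.mem_filter.1 hs').2
            (Finset.mem_filter.1 ht).2 (Finset.mem_filter.1 ht').2
    _ = _ := by
        simp only [Finset.sum_const, card_filter_stub_fst, smul_eq_mul]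
        ring

/-- The mean is at most `2 d_i²/L`, and `d_i/L ≤ (d_i/L)^(s-1)` because `d_i/L ≤ 1` and `s - 1 ≤ 1`.
-/
theorem sum_multigraph_loop_le (hL : 4 ≤ ∑ i, d i) {s : ℝ} (hs2 : s ≤ 2)
    (i : Fin n) :
    ∑ σ : Pairing d, (σ.multigraph s(i, i) : ℝ) ≤
      8 * Fintype.card (Pairing d) * ((d i : ℝ) ^ s / (∑ k, d k : ℕ) ^ (s - 1)) := by
  set L := ∑ k, d k with hLdef
  have hLpos : (0 : ℝ) < L := by exact_mod_cast (by omega : 0 < L)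
  have h1 : (L : ℝ) * ∑ σ : Pairing d, (σ.multigraph s(i, i) : ℝ) ≤
      2 * ((d i : ℝ) * d i) * Fintype.card (Pairing d) := by
    have h2 : L * ∑ σ : Pairing d, σ.multigraph s(i, i) ≤
        2 * (d i * d i) * Fintype.card (Pairing d) :=
      le_trans (Nat.mul_le_mul_left _
        (Finset.sum_le_sum fun σ _ => multigraph_le_card_crossing σ i i))
        (sum_mul_card_crossing_le hL i i)
    exact_mod_cast h2
  rcases Nat.eq_zero_or_pos (d i) with h0 | hpos
  · rw [h0] at h1
    have : ∑ σ : Pairing d, (σ.multigraph s(i, i) : ℝ) ≤ 0 := by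
      by_contra hc
      push Not at hc
      have := mul_pos hLpos hc
      simp at h1
      linarith
    exact this.trans (by positivity)
  have hdpos : (0 : ℝ) < d i := by exact_mod_cast hpos
  have hdL : (d i : ℝ) ≤ L := by
    exact_mod_cast Finset.single_le_sum (fun _ _ => Nat.zero_le _) (Finset.mem_univ i)
  have h3 : (d i : ℝ) * d i / L ≤ (d i : ℝ) ^ s / (L : ℝ) ^ (s - 1) := by
    have : (d i : ℝ) / L ≤ ((d i : ℝ) / L) ^ (s - 1) := by
      conv_lhs => rw [← Real.rpow_one ((d i : ℝ) / L)]
      exact Real.rpow_le_rpow_of_exponent_ge (by positivity) ((div_le_one hLpos).2 hdL)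
        (by linarith)
    calc (d i : ℝ) * d i / L = d i * (d i / L) := by ring
      _ ≤ d i * ((d i : ℝ) / L) ^ (s - 1) := by gcongr
      _ = _ := by
        rw [Real.div_rpow hdpos.le hLpos.le, Real.rpow_sub_one hdpos.ne']
        field_simp
  calc ∑ σ : Pairing d, (σ.multigraph s(i, i) : ℝ)
      ≤ 2 * Fintype.card (Pairing d) * ((d i : ℝ) * d i / L) := by
        rw [mul_comm] at h1
        rw [← le_div_iff₀ hLpos] at h1
        refine h1.trans (le_of_eq ?_)
        ring
    _ ≤ 8 * Fintype.card (Pairing d) * ((d i : ℝ) ^ s / (L : ℝ) ^ (s - 1)) := by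
        gcongr
        norm_num

/-- With `C` crossing stubs the excess is at most `C - 1`, hence at most both `C` and `C(C-1)`.
Their means are bounded by multiples of `x` and `x²`, and `min(x, x²) ≤ x^s`. -/
theorem sum_multigraph_multiple_le (hL : 4 ≤ ∑ i, d i) {s : ℝ} (hs1 : 1 ≤ s) (hs2 : s ≤ 2)
    {i j : Fin n} (hij : i ≠ j) :
    ∑ σ : Pairing d,
      ((σ.multigraph s(i, j) - if 0 < σ.multigraph s(i, j) then 1 else 0 : ℕ) : ℝ) ≤
      8 * Fintype.card (Pairing d) *
        ((d i : ℝ) ^ s * (d j : ℝ) ^ s / (∑ k, d k : ℕ) ^ s) := by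
  set L := ∑ k, d k with hLdef
  have hLpos : (0 : ℝ) < L := by exact_mod_cast (by omega : 0 < L)
  have hle : ∀ σ : Pairing d,
      (σ.multigraph s(i, j) - if 0 < σ.multigraph s(i, j) then 1 else 0) ≤
        (crossing σ i j).card - 1 := by
    intro σ
    have := multigraph_le_card_crossing σ i j
    split_ifs <;> omega
  set A := ∑ σ : Pairing d,
    ((σ.multigraph s(i, j) - if 0 < σ.multigraph s(i, j) then 1 else 0 : ℕ) : ℝ) with hA
  set x : ℝ := d i * d j / L with hx
  have hx0 : 0 ≤ x := by positivity
  have h1 : A ≤ 8 * Fintype.card (Pairing d) * x := by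
    have h2 : L * ∑ σ : Pairing d,
        (σ.multigraph s(i, j) - if 0 < σ.multigraph s(i, j) then 1 else 0) ≤
        2 * (d i * d j) * Fintype.card (Pairing d) :=
      le_trans (Nat.mul_le_mul_left _
        (Finset.sum_le_sum fun σ _ => (hle σ).trans (Nat.sub_le _ _)))
        (sum_mul_card_crossing_le hL i j)
    have h3 : (L : ℝ) * A ≤ 2 * ((d i : ℝ) * d j) * Fintype.card (Pairing d) := by
      rw [hA, ← Nat.cast_sum]
      exact_mod_cast h2
    rw [mul_comm, ← le_div_iff₀ hLpos] at h3
    refine h3.trans ?_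
    rw [show 2 * ((d i : ℝ) * d j) * Fintype.card (Pairing d) / L =
      2 * Fintype.card (Pairing d) * x by rw [hx]; ring]
    gcongr
    norm_num
  have h2 : A ≤ 8 * Fintype.card (Pairing d) * x ^ 2 := by
    have h2 : L ^ 2 * ∑ σ : Pairing d,
        (σ.multigraph s(i, j) - if 0 < σ.multigraph s(i, j) then 1 else 0) ≤
        8 * (d i * d j) ^ 2 * Fintype.card (Pairing d) := by
      refine le_trans (Nat.mul_le_mul_left _
        (Finset.sum_le_sum fun σ _ => (hle σ).trans ?_))
        (sum_sq_mul_card_crossing_mul_pred_le hL hij)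
      rcases Nat.eq_zero_or_pos (crossing σ i j).card with h | h
      · simp [h]
      · exact Nat.le_mul_of_pos_left _ h
    have h3 : (L : ℝ) ^ 2 * A ≤ 8 * ((d i : ℝ) * d j) ^ 2 * Fintype.card (Pairing d) := by
      rw [hA, ← Nat.cast_sum]
      exact_mod_cast h2
    rw [mul_comm, ← le_div_iff₀ (by positivity)] at h3
    refine h3.trans (le_of_eq ?_)
    rw [hx]
    ring
  have h3 : (d i : ℝ) ^ s * (d j : ℝ) ^ s / (L : ℝ) ^ s = x ^ s := by
    rw [hx, Real.div_rpow (by positivity) hLpos.le, Real.mul_rpow (by positivity) (by positivity)]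
  rw [h3]
  rcases le_total x 1 with hx1 | hx1
  · refine h2.trans (mul_le_mul_of_nonneg_left ?_ (by positivity))
    rw [← Real.rpow_natCast]
    exact Real.rpow_le_rpow_of_exponent_ge_of_imp hx0 hx1 (by exact_mod_cast hs2)
      (fun _ h => absurd h (by norm_num))
  · refine h1.trans (mul_le_mul_of_nonneg_left ?_ (by positivity))
    conv_lhs => rw [← Real.rpow_one x]
    exact Real.rpow_le_rpow_of_exponent_le hx1 hs1

/-- Total number of removed edges over all pairings, in terms of power sums of the degrees. -/
theorem sum_removedEdges_le (hL : 4 ≤ ∑ i, d i) {s : ℝ} (hs1 : 1 ≤ s) (hs2 : s ≤ 2) :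
    ∑ σ : Pairing d, (removedEdges σ.multigraph : ℝ) ≤
      8 * Fintype.card (Pairing d) *
        ((∑ i, (d i : ℝ) ^ s) / (∑ k, d k : ℕ) ^ (s - 1) +
          (∑ i, (d i : ℝ) ^ s) ^ 2 / (∑ k, d k : ℕ) ^ s) := by
  simp only [removedEdges, Nat.cast_add, Nat.cast_sum (R := ℝ)]
  rw [Finset.sum_add_distrib, mul_add]
  refine add_le_add ?_ ?_
  · rw [Finset.sum_comm, Finset.sum_div, Finset.mul_sum]
    exact Finset.sum_le_sum fun i _ => by
      simpa only [Nat.cast_sum] using sum_multigraph_loop_le hL hs2 i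
  · rw [Finset.sum_comm, sq, Finset.sum_mul, Finset.sum_div, Finset.mul_sum]
    refine Finset.sum_le_sum fun i _ => ?_
    rw [Finset.sum_comm, Finset.mul_sum, Finset.sum_div, Finset.mul_sum]
    -- Enlarging `i < j` to all pairs makes the double sum factor as a square.
    refine (Finset.sum_le_sum fun j hj => ?_).trans (Finset.sum_le_sum_of_subset_of_nonneg
      (Finset.filter_subset _ _) fun j _ _ => by positivity)
    simpa only [Nat.cast_sum] using
      sum_multigraph_multiple_le hL hs1 hs2 (Finset.mem_filter.1 hj).2.ne

end Crossings

/-! ### Consequences of regular variation for the degree law -/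

section Moments

variable {ν : Measure ℕ} {γ : ℝ}

theorem HasRegularlyVaryingTail.eventually_tail_pos (hν : HasRegularlyVaryingTail ν γ) :
    ∀ᶠ t : ℝ in atTop, 0 < ν.real {k : ℕ | t < (k : ℝ)} := by
  obtain ⟨L, ⟨⟨a, ha, -⟩, -⟩, hL⟩ := hν
  filter_upwards [eventually_ge_atTop a, eventually_gt_atTop 0] with t hat ht
  rw [hL t ht]
  exact mul_pos (ha t hat) (Real.rpow_pos_of_pos ht _)

/-- Slow variation at the single ratio `2` suffices: `L(2t)/L(t) → 1 < 2^(γ-s)`. -/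
theorem HasRegularlyVaryingTail.eventually_tail_two_mul_le (hν : HasRegularlyVaryingTail ν γ)
    {s : ℝ} (hs : s < γ) :
    ∀ᶠ t : ℝ in atTop, ν.real {k : ℕ | 2 * t < (k : ℝ)} ≤
      2 ^ (-s) * ν.real {k : ℕ | t < (k : ℝ)} := by
  obtain ⟨L, ⟨⟨a, ha, -⟩, hlim⟩, hL⟩ := hν
  have h1 : (1 : ℝ) < 2 ^ (γ - s) := Real.one_lt_rpow (by norm_num) (by linarith)
  filter_upwards [eventually_ge_atTop a, eventually_gt_atTop 0,
    (hlim 2 (by norm_num)).eventually_lt_const h1] with t hat ht hlt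
  rw [hL t ht, hL (2 * t) (by positivity), Real.mul_rpow (by norm_num) ht.le]
  rw [div_lt_iff₀ (ha t hat)] at hlt
  calc L (2 * t) * (2 ^ (-γ) * t ^ (-γ))
      ≤ (2 ^ (γ - s) * L t) * (2 ^ (-γ) * t ^ (-γ)) := by gcongr
    _ = (2 ^ (γ - s) * 2 ^ (-γ)) * (L t * t ^ (-γ)) := by ring
    _ = _ := by
      rw [← Real.rpow_add (by norm_num)]
      congr 2
      ring

/-- Pick `s < s' < γ`. Iterating the doubling bound makes the tail at `2^m t₀` at most `2^(-s'm)`,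
so the dyadic decomposition of the moment is dominated by a geometric series of ratio `2^(s-s') <
1`. -/
theorem HasRegularlyVaryingTail.lintegral_rpow_lt_top [IsProbabilityMeasure ν]
    (hν : HasRegularlyVaryingTail ν γ) {s : ℝ} (hs0 : 0 < s) (hs : s < γ) :
    ∫⁻ k, ENNReal.ofReal ((k : ℝ) ^ s) ∂ν < ∞ := by
  obtain ⟨s', hs', hs'γ⟩ := exists_between hs
  obtain ⟨t₀, ht₀⟩ := ((hν.eventually_tail_two_mul_le hs'γ).and
    (eventually_gt_atTop 0)).exists_forall_of_atTop
  have ht₀pos : 0 < t₀ := (ht₀ t₀ le_rfl).2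
  set q : ℝ := 2 ^ (-s') with hq
  have hq0 : 0 < q := by positivity
  have htail : ∀ m : ℕ, ν.real {k : ℕ | 2 ^ m * t₀ < (k : ℝ)} ≤ q ^ m := by
    intro m
    induction m with
    | zero => simp
    | succ m ih =>
      have h := (ht₀ (2 ^ m * t₀) (le_mul_of_one_le_left ht₀pos.le
        (one_le_pow₀ (by norm_num)))).1
      rw [pow_succ', mul_assoc, pow_succ']
      exact h.trans (mul_le_mul_of_nonneg_left ih hq0.le)
  have hr : (2 : ℝ) ^ s * q < 1 := by
    rw [hq, ← Real.rpow_add (by norm_num)]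
    exact Real.rpow_lt_one_of_one_lt_of_neg (by norm_num) (by linarith)
  have hpt : ∀ k : ℕ, ENNReal.ofReal ((k : ℝ) ^ s) ≤ ENNReal.ofReal ((2 * t₀) ^ s) +
      ∑' m : ℕ, Set.indicator {k : ℕ | 2 ^ m * t₀ < (k : ℝ)}
        (fun _ => ENNReal.ofReal ((2 ^ m * (4 * t₀)) ^ s)) k := by
    intro k
    rcases le_total (k : ℝ) (2 * t₀) with h | h
    · exact le_add_right (ENNReal.ofReal_le_ofReal (Real.rpow_le_rpow (by positivity) h hs0.le))
    -- Scaling by `2 * t₀` instead of `t₀` yields the strict inequality `2^m t₀ < k`.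
    · obtain ⟨m, hm1, hm2⟩ := exists_nat_pow_near
        ((one_le_div (by positivity : 0 < 2 * t₀)).2 h) (by norm_num : (1 : ℝ) < 2)
      rw [le_div_iff₀ (by positivity)] at hm1
      rw [div_lt_iff₀ (by positivity), pow_succ] at hm2
      have hp : (0 : ℝ) < 2 ^ m * t₀ := by positivity
      refine le_add_left (le_trans ?_ (ENNReal.le_tsum m))
      have hmem : k ∈ {k : ℕ | 2 ^ m * t₀ < (k : ℝ)} := by
        change (2 : ℝ) ^ m * t₀ < k
        linarith
      rw [Set.indicator_of_mem hmem]
      exact ENNReal.ofReal_le_ofReal (Real.rpow_le_rpow (by positivity) (by linarith) hs0.le)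
  refine (lintegral_mono hpt).trans_lt ?_
  rw [lintegral_add_left measurable_const, lintegral_const, measure_univ, mul_one,
    lintegral_tsum fun m => (measurable_of_countable _).aemeasurable]
  refine ENNReal.add_lt_top.2 ⟨ENNReal.ofReal_lt_top, ?_⟩
  have hsum : Summable fun m : ℕ => (4 * t₀) ^ s * ((2 : ℝ) ^ s * q) ^ m :=
    (summable_geometric_of_lt_one (by positivity) hr).mul_left _
  refine lt_of_le_of_lt (ENNReal.tsum_le_tsum fun m => ?_) hsum.tsum_ofReal_lt_top
  rw [lintegral_indicator_const (MeasurableSet.of_discrete)]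
  rw [← ofReal_measureReal, ← ENNReal.ofReal_mul (by positivity)]
  refine ENNReal.ofReal_le_ofReal ?_
  calc _ ≤ (2 ^ m * (4 * t₀)) ^ s * q ^ m :=
        mul_le_mul_of_nonneg_left (htail m) (by positivity)
    _ = _ := by
      rw [Real.mul_rpow (by positivity) (by positivity), ← Real.rpow_natCast 2 m,
        ← Real.rpow_mul (by norm_num), mul_comm (m : ℝ) s, Real.rpow_mul (by norm_num),
        Real.rpow_natCast, mul_pow]
      ring

/-- The shift by one absorbs the parity correction. -/
theorem HasRegularlyVaryingTail.lintegral_add_one_rpow_lt_top [IsProbabilityMeasure ν]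
    (hν : HasRegularlyVaryingTail ν γ) {s : ℝ} (hs0 : 0 < s) (hs : s < γ) :
    ∫⁻ k, ENNReal.ofReal (((k : ℝ) + 1) ^ s) ∂ν < ∞ := by
  have hpt : ∀ k : ℕ, ENNReal.ofReal (((k : ℝ) + 1) ^ s) ≤
      1 + ENNReal.ofReal (2 ^ s) * ENNReal.ofReal ((k : ℝ) ^ s) := by
    intro k
    rcases Nat.eq_zero_or_pos k with rfl | hk
    · simp
    · refine le_add_left ?_
      rw [← ENNReal.ofReal_mul (by positivity), ← Real.mul_rpow (by norm_num) (by positivity)]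
      have : (1 : ℝ) ≤ k := by exact_mod_cast hk
      exact ENNReal.ofReal_le_ofReal (Real.rpow_le_rpow (by positivity) (by linarith) hs0.le)
  refine (lintegral_mono hpt).trans_lt ?_
  rw [lintegral_add_left measurable_const, lintegral_const, measure_univ, mul_one,
    lintegral_const_mul _ (measurable_of_countable _)]
  exact ENNReal.add_lt_top.2 ⟨ENNReal.one_lt_top,
    ENNReal.mul_lt_top ENNReal.ofReal_lt_top (hν.lintegral_rpow_lt_top hs0 hs)⟩

/-- The tail is eventually positive, so `ν` charges the positive integers. This is what drives the
Chernoff bound. -/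
theorem HasRegularlyVaryingTail.integral_exp_neg_lt_one [IsProbabilityMeasure ν]
    (hν : HasRegularlyVaryingTail ν γ) : ∫ k, Real.exp (-(k : ℝ)) ∂ν < 1 := by
  have hint : Integrable (fun k : ℕ => Real.exp (-(k : ℝ))) ν :=
    Integrable.of_bound (measurable_of_countable _).aestronglyMeasurable 1
      (ae_of_all _ fun k => by
        rw [Real.norm_of_nonneg (Real.exp_pos _).le]
        exact Real.exp_le_one_iff.2 (by simp))
  have hpos : 0 < ∫ k, (1 - Real.exp (-(k : ℝ))) ∂ν := by
    rw [integral_pos_iff_support_of_nonneg (f := fun k : ℕ => 1 - Real.exp (-(k : ℝ))) _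
      ((integrable_const _).sub hint)]
    · obtain ⟨t, ht, ht0⟩ := (hν.eventually_tail_pos.and (eventually_gt_atTop 0)).exists
      refine lt_of_lt_of_le (ENNReal.toReal_pos_iff.1 ht).1 (measure_mono fun k hk => ?_)
      have hk0 : (0 : ℝ) < k := ht0.trans hk
      have : Real.exp (-(k : ℝ)) < 1 := Real.exp_lt_one_iff.2 (by linarith)
      exact (sub_pos.2 this).ne'
    · intro k
      exact sub_nonneg.2 (Real.exp_le_one_iff.2 (by simp))
  rw [integral_sub (integrable_const _) hint] at hpos
  simpa using hpos

end Moments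

/-! ### High-probability bounds on sums and power sums of degrees -/

section DegreeSums

variable {Ω : Type*} [MeasurableSpace Ω] {P : Measure Ω}
  {ν : Measure ℕ} [IsProbabilityMeasure ν] {γ : ℝ}

/-- The sum of the degrees is at least linear in the number of vertices, with high probability. -/
theorem exists_tendsto_measure_sum_le [IsProbabilityMeasure P] (hν : HasRegularlyVaryingTail ν γ)
    (D : (n : ℕ) → Fin n → Ω → ℕ) (hD_meas : ∀ n i, Measurable (D n i))
    (hD_law : ∀ n i, P.map (D n i) = ν) (hD_indep : ∀ n, iIndepFun (D n) P) :
    ∃ c : ℝ, 0 < c ∧ Tendsto (fun n : ℕ => P {ω | ((∑ i, D n i ω : ℕ) : ℝ) ≤ c * n})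
      atTop (𝓝 0) := by
  set ρ := ∫ k, Real.exp (-(k : ℝ)) ∂ν with hρ
  have hρ1 : ρ < 1 := hν.integral_exp_neg_lt_one
  have hρ0 : 0 ≤ ρ := integral_nonneg fun k => (Real.exp_pos _).le
  -- For `c = -log r`, Chernoff with parameter `-1` gives `e^(cn) ρ^n = (ρ/r)^n`. So `r < 1` makes
  -- `c` positive and `ρ < r` gives decay.
  obtain ⟨r, hρr, hr1⟩ := exists_between hρ1
  have hr0 : 0 < r := hρ0.trans_lt hρr
  refine ⟨-Real.log r, neg_pos.2 (Real.log_neg hr0 hr1), ?_⟩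
  have hbound : ∀ n : ℕ, P {ω | ((∑ i, D n i ω : ℕ) : ℝ) ≤ -Real.log r * n} ≤
      ENNReal.ofReal ((ρ / r) ^ n) := by
    intro n
    have hm : ∀ i, Measurable fun ω => (D n i ω : ℝ) :=
      fun i => (measurable_of_countable (fun k : ℕ => (k : ℝ))).comp (hD_meas n i)
    have hind : iIndepFun (fun i ω => (D n i ω : ℝ)) P :=
      (hD_indep n).comp (fun _ (k : ℕ) => (k : ℝ)) fun _ => measurable_of_countable _
    have hmgf : ∀ i, mgf (fun ω => (D n i ω : ℝ)) P (-1) = ρ := by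
      intro i
      rw [hρ, ← hD_law n i, integral_map (hD_meas n i).aemeasurable
        (measurable_of_countable _).aestronglyMeasurable]
      simp [mgf]
    have hsum := hind.mgf_sum hm (t := -1) Finset.univ
    simp only [hmgf, Finset.prod_const, Finset.card_univ, Fintype.card_fin] at hsum
    have hch := measure_le_le_exp_mul_mgf (μ := P)
      (X := ∑ i, fun ω => (D n i ω : ℝ)) (t := -1) (-Real.log r * n) (by norm_num)
      (hind.integrable_exp_mul_sum hm fun i _ =>
        Integrable.of_bound (((hm i).const_mul _).exp.aestronglyMeasurable) 1
          (ae_of_all _ fun ω => by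
            rw [Real.norm_of_nonneg (Real.exp_pos _).le]
            exact Real.exp_le_one_iff.2 (by simp)))
    rw [hsum] at hch
    rw [← ofReal_measureReal]
    refine ENNReal.ofReal_le_ofReal ?_
    have hset : {ω | ((∑ i, D n i ω : ℕ) : ℝ) ≤ -Real.log r * n} =
        {ω | (∑ i, fun ω => (D n i ω : ℝ)) ω ≤ -Real.log r * n} := by
      ext ω
      simp
    rw [hset]
    refine hch.trans (le_of_eq ?_)
    rw [show -(-1) * (-Real.log r * n) = -((n : ℝ) * Real.log r) by ring, Real.exp_neg,
      Real.exp_nat_mul, Real.exp_log hr0, div_pow]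
    ring
  have hlim : Tendsto (fun n : ℕ => ENNReal.ofReal ((ρ / r) ^ n)) atTop (𝓝 0) := by
    rw [← ENNReal.ofReal_zero]
    exact ENNReal.tendsto_ofReal (tendsto_pow_atTop_nhds_zero_of_lt_one (by positivity)
      ((div_lt_one hr0).2 hρr))
  exact tendsto_of_tendsto_of_tendsto_of_le_of_le tendsto_const_nhds hlim
    (fun _ => zero_le) hbound

/-- Power sums of the degrees of order `s < γ` are at most `n ^ (1 + η)`, with high
probability. -/
theorem tendsto_measure_le_sum_rpow (hν : HasRegularlyVaryingTail ν γ)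
    (D : (n : ℕ) → Fin n → Ω → ℕ) (hD_meas : ∀ n i, Measurable (D n i))
    (hD_law : ∀ n i, P.map (D n i) = ν) {s : ℝ} (hs0 : 0 < s) (hs : s < γ)
    {η : ℝ} (hη : 0 < η) :
    Tendsto (fun n : ℕ => P {ω | (n : ℝ) ^ (1 + η) ≤ ∑ i, ((D n i ω : ℝ) + 1) ^ s})
      atTop (𝓝 0) := by
  set M := ∫⁻ k, ENNReal.ofReal (((k : ℝ) + 1) ^ s) ∂ν with hM
  have hMtop : M < ∞ := hν.lintegral_add_one_rpow_lt_top hs0 hs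
  have hbound : ∀ᶠ n : ℕ in atTop,
      P {ω | (n : ℝ) ^ (1 + η) ≤ ∑ i, ((D n i ω : ℝ) + 1) ^ s} ≤
        M * ENNReal.ofReal ((n : ℝ) ^ (-η)) := by
    filter_upwards [eventually_gt_atTop 0] with n hn
    have hn0 : (0 : ℝ) < n := by exact_mod_cast hn
    have hmeas : ∀ i, Measurable fun ω => ENNReal.ofReal (((D n i ω : ℝ) + 1) ^ s) := fun i =>
      (measurable_of_countable fun k : ℕ => ENNReal.ofReal (((k : ℝ) + 1) ^ s)).comp
        (hD_meas n i)
    have hint : ∫⁻ ω, ∑ i, ENNReal.ofReal (((D n i ω : ℝ) + 1) ^ s) ∂P = n * M := by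
      rw [lintegral_finsetSum _ fun i _ => hmeas i]
      have : ∀ i, ∫⁻ ω, ENNReal.ofReal (((D n i ω : ℝ) + 1) ^ s) ∂P = M := fun i => by
        rw [hM, ← hD_law n i, lintegral_map (measurable_of_countable _) (hD_meas n i)]
      simp [this]
    have hmk := meas_ge_le_lintegral_div (μ := P)
      (Finset.measurable_fun_sum Finset.univ fun i _ => hmeas i).aemeasurable
      (ε := ENNReal.ofReal ((n : ℝ) ^ (1 + η)))
      (ENNReal.ofReal_pos.2 (by positivity)).ne' ENNReal.ofReal_ne_top
    rw [hint] at hmk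
    refine (measure_mono fun ω hω => ?_).trans (hmk.trans (le_of_eq ?_))
    · change ENNReal.ofReal _ ≤ _
      rw [← ENNReal.ofReal_sum_of_nonneg fun i _ => by positivity]
      exact ENNReal.ofReal_le_ofReal hω
    · rw [mul_comm, mul_div_assoc, ← ENNReal.ofReal_natCast, ← ENNReal.ofReal_div_of_pos
        (by positivity)]
      congr 2
      rw [Real.rpow_add hn0, Real.rpow_one, Real.rpow_neg hn0.le]
      field_simp
  have hlim : Tendsto (fun n : ℕ => M * ENNReal.ofReal ((n : ℝ) ^ (-η))) atTop (𝓝 0) := by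
    have h := ENNReal.tendsto_ofReal
      ((tendsto_rpow_neg_atTop hη).comp tendsto_natCast_atTop_atTop)
    rw [ENNReal.ofReal_zero] at h
    simpa using ENNReal.Tendsto.const_mul (a := M) h (Or.inr hMtop.ne)
  exact tendsto_of_tendsto_of_tendsto_of_le_of_le' tendsto_const_nhds hlim
    (Eventually.of_forall fun _ => zero_le) hbound

end DegreeSums

/-! ### From fixed degrees to random degrees -/

section ConditionalMarkov

/-- Markov's inequality for the number of removed edges under the uniform pairing. -/
theorem tsum_cmProb_le {n : ℕ} (d : Fin n → ℕ) {T B : ℝ} (hT : 0 < T)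
    (hB : ∑ σ : Pairing d, (removedEdges σ.multigraph : ℝ) ≤ Fintype.card (Pairing d) * B) :
    ∑' g : {g : Multigraph n // T ≤ removedEdges g}, cmProb d g.1 ≤ ENNReal.ofReal (B / T) := by
  set A := Finset.univ.filter fun σ : Pairing d => T ≤ removedEdges σ.multigraph with hA
  have hsum : ∑' g : {g : Multigraph n // T ≤ removedEdges g}, cmProb d g.1 ≤
      (A.card : ℝ≥0∞) / Fintype.card (Pairing d) := by
    simp only [cmProb, div_eq_mul_inv]
    rw [ENNReal.tsum_mul_right]
    refine mul_le_mul_left ?_ _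
    simp only [Finset.card_filter, Nat.cast_sum, Nat.cast_ite, Nat.cast_one, Nat.cast_zero]
    -- After exchanging the sums, each pairing contributes through one multigraph only, its own.
    rw [Summable.tsum_finsetSum fun _ _ => ENNReal.summable, hA, Finset.card_filter,
      Nat.cast_sum]
    refine Finset.sum_le_sum fun σ _ => ?_
    by_cases h : T ≤ removedEdges σ.multigraph
    · rw [if_pos h, tsum_eq_single ⟨σ.multigraph, h⟩]
      · simp
      · rintro ⟨g, hg⟩ hne
        exact if_neg fun h' => hne (Subtype.ext h'.symm)
    · rw [if_neg h, Nat.cast_zero, nonpos_iff_eq_zero, ENNReal.tsum_eq_zero]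
      rintro ⟨g, hg⟩
      refine if_neg ?_
      rintro rfl
      exact h hg
  refine hsum.trans (ENNReal.div_le_of_le_mul ?_)
  have hmarkov : (A.card : ℝ) * T ≤ Fintype.card (Pairing d) * B := by
    refine le_trans ?_ hB
    rw [← nsmul_eq_mul]
    refine (Finset.card_nsmul_le_sum A _ T fun σ hσ => (Finset.mem_filter.1 hσ).2).trans ?_
    exact Finset.sum_le_sum_of_subset_of_nonneg (Finset.subset_univ _)
      fun σ _ _ => Nat.cast_nonneg _
  rw [← ENNReal.ofReal_natCast, ← ENNReal.ofReal_natCast (Fintype.card _),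
    ← ENNReal.ofReal_mul' (Nat.cast_nonneg _)]
  refine ENNReal.ofReal_le_ofReal ?_
  rw [← le_div_iff₀ hT] at hmarkov
  refine hmarkov.trans (le_of_eq ?_)
  ring

/-- A bound on the removed edges that holds conditionally on each degree sequence of a class
bounds the probability of many removed edges while the degrees lie in that class. -/
theorem IsConfigurationModel.measure_le {Ω : Type*} [MeasurableSpace Ω] {P : Measure Ω}
    [IsProbabilityMeasure P] {n : ℕ} {D : Fin n → Ω → ℕ} {G : Ω → Multigraph n}
    (hG : IsConfigurationModel P D G) (hD : ∀ i, Measurable (D i))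
    (good : (Fin n → ℕ) → Prop) {T B : ℝ} (hT : 0 < T)
    (hB : ∀ d, good d → ∑ σ : Pairing (evenCorrection d), (removedEdges σ.multigraph : ℝ) ≤
      Fintype.card (Pairing (evenCorrection d)) * B) :
    P {ω | good (fun i => D i ω) ∧ T ≤ removedEdges (G ω)} ≤ ENNReal.ofReal (B / T) := by
  -- Degree sequences and multigraphs are countable, so a union bound over atoms stands in for
  -- conditional expectation.
  have hcover : {ω | good (fun i => D i ω) ∧ T ≤ removedEdges (G ω)} ⊆
      ⋃ d : {d : Fin n → ℕ // good d}, ⋃ g : {g : Multigraph n // T ≤ removedEdges g},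
        {ω | (∀ i, D i ω = d.1 i) ∧ G ω = g.1} := by
    rintro ω ⟨h1, h2⟩
    simp only [Set.mem_iUnion]
    exact ⟨⟨_, h1⟩, ⟨_, h2⟩, fun i => rfl, rfl⟩
  have hmeas : ∀ d : Fin n → ℕ, MeasurableSet {ω | ∀ i, D i ω = d i} := by
    intro d
    simp only [Set.ofPred_forall]
    exact MeasurableSet.iInter fun i => hD i (measurableSet_singleton (d i))
  have hmass : ∑' d : {d : Fin n → ℕ // good d}, P {ω | ∀ i, D i ω = d.1 i} ≤ 1 := by
    rw [← measure_univ (μ := P)]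
    refine tsum_measure_le_measure_univ (fun d => (hmeas d.1).nullMeasurableSet) ?_
    intro d d' hne
    refine Disjoint.aedisjoint (Set.disjoint_left.2 fun ω h h' => hne (Subtype.ext ?_))
    exact funext fun i => (h i).symm.trans (h' i)
  calc P {ω | good (fun i => D i ω) ∧ T ≤ removedEdges (G ω)}
      ≤ ∑' d : {d : Fin n → ℕ // good d}, ∑' g : {g : Multigraph n // T ≤ removedEdges g},
          P {ω | (∀ i, D i ω = d.1 i) ∧ G ω = g.1} :=
        (measure_mono hcover).trans ((measure_iUnion_le _).trans
          (ENNReal.tsum_le_tsum fun d => measure_iUnion_le _))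
    _ ≤ ∑' d : {d : Fin n → ℕ // good d},
          P {ω | ∀ i, D i ω = d.1 i} * ENNReal.ofReal (B / T) := by
        refine ENNReal.tsum_le_tsum fun d => ?_
        simp only [hG.cond_law]
        rw [ENNReal.tsum_mul_left]
        exact mul_le_mul_right (tsum_cmProb_le _ hT (hB d.1 d.2)) _
    _ ≤ ENNReal.ofReal (B / T) := by
        rw [ENNReal.tsum_mul_right]
        exact (mul_le_mul_left hmass _).trans (one_mul _).le

end ConditionalMarkov

/-! ### Parity correction and conclusion -/

theorem le_evenCorrection {n : ℕ} (d : Fin n → ℕ) (i : Fin n) : d i ≤ evenCorrection d i := by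
  unfold evenCorrection
  split_ifs <;> omega

theorem evenCorrection_le {n : ℕ} (d : Fin n → ℕ) (i : Fin n) :
    evenCorrection d i ≤ d i + 1 := by
  unfold evenCorrection
  split_ifs <;> omega

/-- Inserting `L ≥ c n` and `S ≤ n^(1+η)`, loops give exponent `2 + η - s`, which is absorbed into
the exponent `2 + 2η - s` of the multiple edges. -/
theorem sum_removedEdges_evenCorrection_le {n : ℕ} (hn : 0 < n) {s η c : ℝ} (hs1 : 1 ≤ s)
    (hs2 : s ≤ 2) (hη : 0 ≤ η) (hc : 0 < c) (hcn : 4 ≤ c * n) {d : Fin n → ℕ}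
    (hd1 : c * n ≤ (∑ i, d i : ℕ)) (hd2 : ∑ i, ((d i : ℝ) + 1) ^ s ≤ (n : ℝ) ^ (1 + η)) :
    ∑ σ : Pairing (evenCorrection d), (removedEdges σ.multigraph : ℝ) ≤
      Fintype.card (Pairing (evenCorrection d)) *
        (8 * (c ^ (1 - s) + c ^ (-s)) * (n : ℝ) ^ (2 + 2 * η - s)) := by
  have hn1 : (1 : ℝ) ≤ n := by exact_mod_cast hn
  have hn0 : (0 : ℝ) < n := by linarith
  have hcn0 : 0 < c * n := by positivity
  have hL : c * n ≤ (∑ i, evenCorrection d i : ℕ) :=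
    hd1.trans (by exact_mod_cast Finset.sum_le_sum fun i _ => le_evenCorrection d i)
  have hS : ∑ i, (evenCorrection d i : ℝ) ^ s ≤ (n : ℝ) ^ (1 + η) := by
    refine le_trans (Finset.sum_le_sum fun i _ => ?_) hd2
    exact Real.rpow_le_rpow (by positivity) (by exact_mod_cast evenCorrection_le d i)
      (by linarith)
  have hS0 : 0 ≤ ∑ i, (evenCorrection d i : ℝ) ^ s :=
    Finset.sum_nonneg fun i _ => by positivity
  refine (sum_removedEdges_le (by exact_mod_cast hcn.trans hL) hs1 hs2).trans ?_
  rw [mul_comm (8 : ℝ) (Fintype.card _ : ℝ), mul_assoc, mul_assoc 8]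
  refine mul_le_mul_of_nonneg_left (mul_le_mul_of_nonneg_left ?_ (by norm_num)) (by positivity)
  rw [add_mul]
  refine add_le_add ?_ ?_
  · calc _ ≤ (n : ℝ) ^ (1 + η) / (c * n) ^ (s - 1) := by
          refine div_le_div₀ (by positivity) hS (by positivity) ?_
          exact Real.rpow_le_rpow hcn0.le hL (by linarith)
      _ = c ^ (1 - s) * (n : ℝ) ^ (2 + η - s) := by
          rw [Real.mul_rpow hc.le hn0.le, show 1 - s = -(s - 1) by ring, Real.rpow_neg hc.le,
            show 2 + η - s = (1 + η) - (s - 1) by ring, Real.rpow_sub hn0 (1 + η)]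
          field_simp
      _ ≤ _ := by
          refine mul_le_mul_of_nonneg_left ?_ (by positivity)
          exact Real.rpow_le_rpow_of_exponent_le hn1 (by linarith)
  · calc _ ≤ ((n : ℝ) ^ (1 + η)) ^ 2 / (c * n) ^ s := by
          refine div_le_div₀ (by positivity) (by gcongr) (by positivity) ?_
          exact Real.rpow_le_rpow hcn0.le hL (by linarith)
      _ = _ := by
          rw [Real.mul_rpow hc.le hn0.le, Real.rpow_neg hc.le,
            show 2 + 2 * η - s = (1 + η) * 2 - s by ring, Real.rpow_sub hn0,
            Real.rpow_mul hn0.le, Real.rpow_two]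
          field_simp

theorem theorem2p1 {Ω : Type*} [MeasurableSpace Ω] (P : Measure Ω) [IsProbabilityMeasure P]
    (ν : Measure ℕ) [IsProbabilityMeasure ν] (γ : ℝ) (hγ1 : 1 < γ) (hγ2 : γ < 2)
    (hν : HasRegularlyVaryingTail ν γ)
    (D : (n : ℕ) → Fin n → Ω → ℕ)
    (hD_meas : ∀ n i, Measurable (D n i))
    (hD_law : ∀ n i, P.map (D n i) = ν)
    (hD_indep : ∀ n, iIndepFun (D n) P)
    (G : (n : ℕ) → Ω → Multigraph n)
    (hG : ∀ n, IsConfigurationModel P (D n) (G n))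
    (δ : ℝ) (hδ : 0 < δ) :
    TendstoInMeasure P
      (fun (n : ℕ) (ω : Ω) => (removedEdges (G n ω) : ℝ) / (n : ℝ) ^ (2 - γ + δ))
      atTop (fun _ => (0 : ℝ)) := by
  -- With `s > γ - δ/2` and `η = δ/8`, the exponent `2 + 2η - s` stays below `2 - γ + δ` by `3δ/4 +
  -- s - γ > δ/4`.
  obtain ⟨s, hs, hsγ⟩ := exists_between (max_lt hγ1 (by linarith : γ - δ / 2 < γ))
  obtain ⟨hs1, hsδ⟩ := max_lt_iff.1 hs
  obtain ⟨c, hc, hlin⟩ := exists_tendsto_measure_sum_le hν D hD_meas hD_law hD_indep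
  have hη : 0 < δ / 8 := by positivity
  have hpow := tendsto_measure_le_sum_rpow hν D hD_meas hD_law (by linarith : 0 < s) hsγ hη
  rw [tendstoInMeasure_iff_norm]
  intro ε hε
  set K := 8 * (c ^ (1 - s) + c ^ (-s)) with hK
  have hlim : Tendsto (fun n : ℕ => ENNReal.ofReal
      (K * (n : ℝ) ^ (2 + 2 * (δ / 8) - s) / (ε * (n : ℝ) ^ (2 - γ + δ)))) atTop (𝓝 0) := by
    rw [← ENNReal.ofReal_zero]
    refine ENNReal.tendsto_ofReal ?_
    have h := ((tendsto_rpow_neg_atTop (by linarith : 0 < 3 * δ / 4 + s - γ)).comp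
      tendsto_natCast_atTop_atTop).const_mul (K / ε)
    rw [mul_zero] at h
    refine h.congr' ?_
    filter_upwards [eventually_gt_atTop 0] with n hn
    have hn0 : (0 : ℝ) < n := by exact_mod_cast hn
    rw [Function.comp_apply, show -(3 * δ / 4 + s - γ) =
      (2 + 2 * (δ / 8) - s) - (2 - γ + δ) by ring, Real.rpow_sub hn0]
    field_simp
  have hsum := (hlin.add hpow).add hlim
  simp only [add_zero] at hsum
  refine tendsto_of_tendsto_of_tendsto_of_le_of_le' tendsto_const_nhds hsum
    (Eventually.of_forall fun _ => zero_le) ?_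
  have hlarge : ∀ᶠ n : ℕ in atTop, 4 ≤ c * n :=
    (tendsto_natCast_atTop_atTop.const_mul_atTop hc).eventually_ge_atTop 4
  filter_upwards [hlarge, eventually_gt_atTop 0] with n hcn hn
  have hn0 : (0 : ℝ) < n := by exact_mod_cast hn
  have hgood := (hG n).measure_le (hD_meas n)
    (fun d => c * n ≤ (∑ i, d i : ℕ) ∧ ∑ i, ((d i : ℝ) + 1) ^ s ≤ (n : ℝ) ^ (1 + δ / 8))
    (T := ε * (n : ℝ) ^ (2 - γ + δ)) (by positivity)
    (fun d hd => sum_removedEdges_evenCorrection_le hn hs1.le (by linarith) hη.le hc hcn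
      hd.1 hd.2)
  refine le_trans ?_ (add_le_add le_rfl hgood)
  refine le_trans ?_ (add_le_add (measure_union_le _ _) le_rfl)
  refine le_trans (measure_mono fun ω hω => ?_) (measure_union_le _ _)
  change ε ≤ ‖(removedEdges (G n ω) : ℝ) / (n : ℝ) ^ (2 - γ + δ) - 0‖ at hω
  rw [sub_zero, Real.norm_of_nonneg (by positivity), le_div_iff₀ (by positivity)] at hω
  -- Either the degree total is small, or the power sum is large, or the degrees are good and the
  -- conditional bound applies.
  by_cases h1 : ((∑ i, D n i ω : ℕ) : ℝ) ≤ c * n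
  · exact Or.inl (Or.inl h1)
  by_cases h2 : (n : ℝ) ^ (1 + δ / 8) ≤ ∑ i, ((D n i ω : ℝ) + 1) ^ s
  · exact Or.inl (Or.inr h2)
  · exact Or.inr ⟨⟨(not_le.1 h1).le, (not_le.1 h2).le⟩, hω⟩
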